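/- Let $d\ge 1$, let $D\subset\mathbb R^d$ be a bounded open set (for instance a bounded convex Lipschitz polyhedron with $d\in\{1,2,3\}$), let $V=H^1_0(D)$ (the closure of $C_c^\infty(D)$ in $H^1(D)$) with norm $\|v\|_V=\|\nabla v\|_{L^2(D)}$, let $V^*$ be its dual with the dual norm, and let $U=[-\tfrac12,\tfrac12]^{\mathbb N}$. Let $a_0,\psi_1,\psi_2,\dots$ be measurable real functions on $D$ with $0<a_{0,\min}\le a_0\le a_{0,\max}<\infty$ a.e. on $D$ for constants $a_{0,\min},a_{0,\max}$, and put $$a(x,y)=a_0(x)+\sum_{j\ge1}y_j\psi_j(x),\qquad x\in D,\ y\in U .$$ Suppose that there are $\overline\kappa\in(0,1)$ and a sequence $b=(b_j)_{j\ge1}$ with $0<b_j\le1$ such that $$\Big\|\sum_{j\ge1}\frac{|\psi_j|}{2a_0}\Big\|_{L^\infty(D)}\le\overline\kappa,\qquad \kappa:=\Big\|\sum_{j\ge1}\frac{|\psi_j|/b_j}{2a_0}\Big\|_{L^\infty(D)}<1 .$$ Let $\mathcal F_1$ be the set of finitely supported $\nu\in\{0,1\}^{\mathbb N}$, $|\nu|=\sum_j\nu_j$,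 $b^\nu=\prod_j b_j^{\nu_j}$, and for $\nu\in\mathcal F_1$ and $k\in\mathbb N_0$ put $$\widetilde\kappa(\nu)=\Big\|\sum_{j\in\mathrm{supp}(\nu)}\frac{|\psi_j|/b_j}{2a_0}\Big\|_{L^\infty(D)},\qquad \kappa(k)=\sup_{\nu\in\mathcal F_1,\ |\nu|=k}\widetilde\kappa(\nu).$$ Then $\widetilde\kappa(\nu)\le\kappa(k)\le\kappa<1$ for all $k\in\mathbb N_0$ and all $\nu\in\mathcal F_1$ with $|\nu|=k$. Moreover, for every $f\in V^*$ and every $y\in U$ there is a unique $u(\cdot,y)\in V$ with $$\int_D a(x,y)\,\nabla u(x,y)\cdot\nabla v(x)\,dx=\langle f,v\rangle_{V^*\times V}\qquad\text{for all }v\in V,$$ and for every $\nu\in\mathcal F_1$ the mixed derivative $\partial^\nu u(\cdot,y)$ with respect to $y$ exists in $V$ for all $y\in U$ (as an iterated partial derivative, one-sided where $y_j=\pm\tfrac12$, and independent of the order of differentiation) and satisfies $$\|\partial^\nu u(\cdot,y)\|_V\le b^\nu\left(\frac{2\kappa(|\nu|)}{1-\overline\kappa}\right)^{|\nu|}\frac{\|f\|_{V^*}}{(1-\overline\kappa)\,a_{0,\min}}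 .$$ -/

import Mathlib

open MeasureTheory Set
open scoped ENNReal ContDiff Gradient

noncomputable section

namespace ParametricPDE

/-- A bounded open set `D ⊆ ℝ^d`. -/
structure BoundedOpen (d : ℕ) where
  carrier : Set (EuclideanSpace ℝ (Fin d))
  isOpen : IsOpen carrier
  isBounded : Bornology.IsBounded carrier

variable {d : ℕ}

/-- Lebesgue measure on `D`. -/
abbrev BoundedOpen.vol (D : BoundedOpen d) : Measure (EuclideanSpace ℝ (Fin d)) :=
  volume.restrict D.carrier

/-! ### The Sobolev space `V = H₀¹(D)` with the norm `‖∇v‖_{L²(D)}` -/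

/-- `φ ∈ C_c^∞(D)`. -/
def IsTest (D : BoundedOpen d) (φ : EuclideanSpace ℝ (Fin d) → ℝ) : Prop :=
  ContDiff ℝ ∞ φ ∧ HasCompactSupport φ ∧ tsupport φ ⊆ D.carrier

/-- The pairs `(φ, ∇φ)`, `φ ∈ C_c^∞(D)`, as a subspace of `L²(D) × L²(D; ℝ^d)`. -/
def testGraph (D : BoundedOpen d) :
    Submodule ℝ (Lp ℝ 2 D.vol × Lp (EuclideanSpace ℝ (Fin d)) 2 D.vol) where
  carrier := {p | ∃ φ, IsTest D φ ∧ p.1 =ᵐ[D.vol] φ ∧ p.2 =ᵐ[D.vol] fun x => ∇ φ x}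
  add_mem' := by
    rintro p q ⟨φ, ⟨h1, h2, h3⟩, h4, h5⟩ ⟨χ, ⟨k1, k2, k3⟩, k4, k5⟩
    refine ⟨φ + χ, ⟨h1.add k1, h2.add k2, (tsupport_add φ χ).trans (union_subset h3 k3)⟩, ?_, ?_⟩
    · filter_upwards [Lp.coeFn_add p.1 q.1, h4, k4] with x a b c
      exact a.trans (by simp [b, c])
    · filter_upwards [Lp.coeFn_add p.2 q.2, h5, k5] with x a b c
      have e1 : DifferentiableAt ℝ φ x := h1.differentiable (by simp) x
      have e2 : DifferentiableAt ℝ χ x := k1.differentiable (by simp) x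
      exact a.trans (by simp [b, c, gradient, fderiv_add e1 e2])
  zero_mem' := by
    refine ⟨0, ⟨contDiff_const, HasCompactSupport.zero, by simp [tsupport]⟩, Lp.coeFn_zero _ _ _, ?_⟩
    filter_upwards [Lp.coeFn_zero (EuclideanSpace ℝ (Fin d)) 2 D.vol] with x a
    have : fderiv ℝ (0 : EuclideanSpace ℝ (Fin d) → ℝ) x = 0 := by simp
    exact a.trans (by simp [gradient])
  smul_mem' := by
    rintro c p ⟨φ, ⟨h1, h2, h3⟩, h4, h5⟩
    refine ⟨c • φ, ⟨contDiff_const.smul h1, h2.smul_left (f := fun _ => c),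
      (closure_mono (Function.support_const_smul_subset c φ)).trans h3⟩, ?_, ?_⟩
    · filter_upwards [Lp.coeFn_smul c p.1, h4] with x a b
      simp [a, b]
    · filter_upwards [Lp.coeFn_smul c p.2, h5] with x a b
      have e1 : DifferentiableAt ℝ φ x := h1.differentiable (by simp) x
      simp [a, b, gradient, fderiv_const_smul e1]

/-- `V = H₀¹(D)`, the closure of `C_c^∞(D)` in `H¹(D)`; an element is stored as the pair
`(v, ∇v)` of an `L²(D)` function and its weak gradient. -/
def H01 (D : BoundedOpen d) : Type := ↥(testGraph D).topologicalClosure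

instance (D : BoundedOpen d) : AddCommGroup (H01 D) :=
  inferInstanceAs (AddCommGroup ↥(testGraph D).topologicalClosure)

instance (D : BoundedOpen d) : Module ℝ (H01 D) :=
  inferInstanceAs (Module ℝ ↥(testGraph D).topologicalClosure)

/-- The `L²(D)` function underlying `v ∈ H₀¹(D)`. -/
def H01.toL2 (D : BoundedOpen d) : H01 D →ₗ[ℝ] Lp ℝ 2 D.vol :=
  (LinearMap.fst ℝ _ _).comp (testGraph D).topologicalClosure.subtype

/-- The weak gradient `∇v ∈ L²(D; ℝ^d)` of `v ∈ H₀¹(D)`. -/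
def H01.grad (D : BoundedOpen d) : H01 D →ₗ[ℝ] Lp (EuclideanSpace ℝ (Fin d)) 2 D.vol :=
  (LinearMap.snd ℝ _ _).comp (testGraph D).topologicalClosure.subtype

/-- An integral of a function vanishing outside `D`. -/
theorem setIntegral_eq_of_zero {D : BoundedOpen d} {g : EuclideanSpace ℝ (Fin d) → ℝ}
    (h : ∀ x ∉ D.carrier, g x = 0) : ∫ x, g x ∂D.vol = ∫ x, g x :=
  setIntegral_eq_integral_of_forall_compl_eq_zero h

/-- The gradient components stored in `H01 D` are the weak gradients of the functions. -/
theorem H01.weak_gradient (D : BoundedOpen d) (v : H01 D)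
    (χ : EuclideanSpace ℝ (Fin d) → ℝ) (hχ : IsTest D χ) (e : EuclideanSpace ℝ (Fin d)) :
    ∫ x, H01.toL2 D v x * fderiv ℝ χ x e ∂D.vol = - ∫ x, inner ℝ (H01.grad D v x) e * χ x ∂D.vol := by
  obtain ⟨k1, k2, k3⟩ := hχ
  have hdc : Continuous fun x => fderiv ℝ χ x e :=
    (k1.continuous_fderiv (by simp)).clm_apply continuous_const
  have hds : HasCompactSupport fun x => fderiv ℝ χ x e :=
    (k2.fderiv ℝ).comp_left (g := fun L : EuclideanSpace ℝ (Fin d) →L[ℝ] ℝ => L e) (by simp)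
  have m1 : MemLp (fun x => fderiv ℝ χ x e) 2 D.vol :=
    (hdc.memLp_of_hasCompactSupport hds).restrict _
  have m2 : MemLp (fun x => χ x • e) 2 D.vol :=
    ((k1.continuous.smul continuous_const).memLp_of_hasCompactSupport k2.smul_right).restrict _
  have f1 : ∀ g : Lp ℝ 2 D.vol, ∫ x, g x * fderiv ℝ χ x e ∂D.vol = inner ℝ (m1.toLp _) g := by
    intro g
    rw [L2.inner_def]
    refine integral_congr_ae ?_
    filter_upwards [m1.coeFn_toLp] with x a
    simp [a]
  have f2 : ∀ g : Lp (EuclideanSpace ℝ (Fin d)) 2 D.vol,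
      ∫ x, inner ℝ (g x) e * χ x ∂D.vol = inner ℝ (m2.toLp _) g := by
    intro g
    rw [L2.inner_def]
    refine integral_congr_ae ?_
    filter_upwards [m2.coeFn_toLp] with x a
    rw [a, real_inner_smul_left, real_inner_comm, mul_comm]
  rw [f1, f2]
  have hclosed : IsClosed {p : Lp ℝ 2 D.vol × Lp (EuclideanSpace ℝ (Fin d)) 2 D.vol |
      inner ℝ (m1.toLp _) p.1 = - inner ℝ (m2.toLp _) p.2} :=
    isClosed_eq (by fun_prop) (by fun_prop)
  refine closure_minimal ?_ hclosed v.2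
  rintro p ⟨φ, ⟨h1, h2, h3⟩, h4, h5⟩
  have hd : Differentiable ℝ φ := h1.differentiable (by simp)
  have hφc : Continuous fun x => fderiv ℝ φ x e :=
    (h1.continuous_fderiv (by simp)).clm_apply continuous_const
  rw [mem_ofPred_eq, ← f1, ← f2]
  have e1 : ∫ x, p.1 x * fderiv ℝ χ x e ∂D.vol = ∫ x, φ x * fderiv ℝ χ x e := by
    rw [← setIntegral_eq_of_zero (D := D)]
    · refine integral_congr_ae ?_
      filter_upwards [h4] with x a
      rw [a]
    · intro x hx
      rw [image_eq_zero_of_notMem_tsupport fun h => hx (h3 h), zero_mul]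
  have e2 : ∫ x, inner ℝ (p.2 x) e * χ x ∂D.vol = ∫ x, fderiv ℝ φ x e * χ x := by
    rw [← setIntegral_eq_of_zero (D := D)]
    · refine integral_congr_ae ?_
      filter_upwards [h5] with x a
      rw [a]
      simp [gradient]
    · intro x hx
      rw [image_eq_zero_of_notMem_tsupport (f := χ) fun h => hx (k3 h), mul_zero]
  rw [e1, e2]
  refine integral_mul_fderiv_eq_neg_fderiv_mul_of_integrable ?_ ?_ ?_
    (fun x _ => hd x) (fun x _ => k1.differentiable (by simp) x)
  · exact (hφc.mul k1.continuous).integrable_of_hasCompactSupport k2.mul_left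
  · exact (h1.continuous.mul hdc).integrable_of_hasCompactSupport h2.mul_right
  · exact (h1.continuous.mul k1.continuous).integrable_of_hasCompactSupport h2.mul_right

/-- The Poincaré inequality on test functions. -/
theorem poincare_test [NeZero d] (D : BoundedOpen d) : ∃ C : ℝ, ∀ p ∈ testGraph D,
    ‖p.1‖ ≤ C * ‖p.2‖ := by
  obtain ⟨R, hR0, hR⟩ := D.isBounded.exists_pos_norm_le
  refine ⟨2 * R, ?_⟩
  rintro p ⟨φ, ⟨h1, h2, h3⟩, h4, h5⟩
  have hz : ∀ x ∉ D.carrier, φ x = 0 := fun x hx =>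
    image_eq_zero_of_notMem_tsupport fun h => hx (h3 h)
  have hd : Differentiable ℝ φ := h1.differentiable (by simp)
  have hc : Continuous φ := h1.continuous
  have hfc : Continuous (fderiv ℝ φ) := h1.continuous_fderiv (by simp)
  have hfz : ∀ x ∉ D.carrier, fderiv ℝ φ x = 0 := fun x hx =>
    image_eq_zero_of_notMem_tsupport fun h => hx (h3 (tsupport_fderiv_subset ℝ h))
  have hfs : HasCompactSupport (fderiv ℝ φ) := h2.fderiv ℝ
  have hn : ∀ x, ‖∇ φ x‖ = ‖fderiv ℝ φ x‖ := fun x => by simp [gradient]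
  have n1 : ‖p.1‖ ^ 2 = ∫ x, φ x ^ 2 := by
    rw [← real_inner_self_eq_norm_sq, L2.inner_def, ← setIntegral_eq_of_zero (D := D)]
    · refine integral_congr_ae ?_
      filter_upwards [h4] with x a
      simp [a, sq]
    · intro x hx; simp [hz x hx]
  have n2 : ‖p.2‖ ^ 2 = ∫ x, ‖fderiv ℝ φ x‖ ^ 2 := by
    rw [← real_inner_self_eq_norm_sq, L2.inner_def, ← setIntegral_eq_of_zero (D := D)]
    · refine integral_congr_ae ?_
      filter_upwards [h5] with x a
      rw [a, real_inner_self_eq_norm_sq, hn]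
    · intro x hx; simp [hfz x hx]
  set e : EuclideanSpace ℝ (Fin d) := EuclideanSpace.single 0 1 with he
  have hen : ‖e‖ = 1 := by simp [he]
  set ℓ : EuclideanSpace ℝ (Fin d) →L[ℝ] ℝ := EuclideanSpace.proj 0 with hℓ
  have hle : ℓ e = 1 := by simp [hℓ, he]
  have i1 : Integrable fun x => φ x ^ 2 :=
    (hc.pow 2).integrable_of_hasCompactSupport (by simpa [sq] using! h2.mul_right (f' := φ))
  have i2 : Integrable fun x => ‖fderiv ℝ φ x‖ ^ 2 :=
    (hfc.norm.pow 2).integrable_of_hasCompactSupport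
      (by simpa [sq] using! hfs.norm.mul_right (f' := fun x => ‖fderiv ℝ φ x‖))
  have hsq : ∀ x, HasFDerivAt (fun x => φ x ^ 2) ((2 * φ x) • fderiv ℝ φ x) x := fun x => by
    simpa using (hd x).hasFDerivAt.pow 2
  have hsq' : ∀ x, fderiv ℝ (fun x => φ x ^ 2) x e = 2 * φ x * fderiv ℝ φ x e := fun x => by
    rw [(hsq x).fderiv]; simp
  have hs2 : HasCompactSupport fun x => φ x ^ 2 := by
    simpa [sq] using! h2.mul_right (f' := φ)
  have key : ∫ x, φ x ^ 2 = - ∫ x, (2 * φ x * fderiv ℝ φ x e) * ℓ x := by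
    have := integral_mul_fderiv_eq_neg_fderiv_mul_of_integrable (μ := volume)
      (f := fun x => φ x ^ 2) (g := fun x => ℓ x) (v := e) ?_ ?_ ?_ ?_ ?_
    · simpa [hsq', hle] using this
    · simp only [hsq']
      refine Continuous.integrable_of_hasCompactSupport (by fun_prop) ?_
      exact ((h2.mul_left (f := fun _ => (2 : ℝ))).mul_right).mul_right
    · simpa [hle] using i1
    · exact Continuous.integrable_of_hasCompactSupport (by fun_prop) hs2.mul_right
    · intro x _; exact (hsq x).differentiableAt
    · intro x _; exact ℓ.differentiableAt
  have hpt : ∀ x, -((2 * φ x * fderiv ℝ φ x e) * ℓ x) ≤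
      (1 / 2) * φ x ^ 2 + 2 * R ^ 2 * ‖fderiv ℝ φ x‖ ^ 2 := by
    intro x
    by_cases hx : x ∈ D.carrier
    · have b1 : |fderiv ℝ φ x e| ≤ ‖fderiv ℝ φ x‖ := by
        simpa [hen] using (fderiv ℝ φ x).le_opNorm e
      have b2 : |ℓ x| ≤ R := by
        have : ‖x 0‖ ≤ ‖x‖ := PiLp.norm_apply_le x 0
        exact this.trans (hR x hx)
      have b3 : |fderiv ℝ φ x e * ℓ x| ≤ ‖fderiv ℝ φ x‖ * R := by
        rw [abs_mul]; gcongr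
      have b4 : (fderiv ℝ φ x e * ℓ x) ^ 2 ≤ (‖fderiv ℝ φ x‖ * R) ^ 2 := by
        rw [← sq_abs]; gcongr
      nlinarith [sq_nonneg (φ x + 2 * (fderiv ℝ φ x e * ℓ x))]
    · simp [hz x hx]; positivity
  have hle2 : ∫ x, φ x ^ 2 ≤ ∫ x, ((1 / 2) * φ x ^ 2 + 2 * R ^ 2 * ‖fderiv ℝ φ x‖ ^ 2) := by
    rw [key, ← integral_neg]
    refine integral_mono ?_ ((i1.const_mul _).add (i2.const_mul _)) hpt
    refine Integrable.neg (Continuous.integrable_of_hasCompactSupport (by fun_prop) ?_)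
    exact ((h2.mul_left (f := fun _ => (2 : ℝ))).mul_right).mul_right
  rw [integral_add (i1.const_mul _) (i2.const_mul _), integral_const_mul, integral_const_mul,
    ← n1, ← n2] at hle2
  refine (pow_le_pow_iff_left₀ (norm_nonneg _) (by positivity) two_ne_zero).1 ?_
  nlinarith

/-- On a bounded open set a function in `H₀¹(D)` is determined by its gradient. -/
theorem H01.grad_injective [NeZero d] (D : BoundedOpen d) :
    Function.Injective (H01.grad D) := by
  obtain ⟨C, hC⟩ := poincare_test D
  have hcl : ∀ p ∈ (testGraph D).topologicalClosure, ‖p.1‖ ≤ C * ‖p.2‖ := by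
    intro p hp
    have hclosed : IsClosed {p : Lp ℝ 2 D.vol × Lp (EuclideanSpace ℝ (Fin d)) 2 D.vol |
        ‖p.1‖ ≤ C * ‖p.2‖} := isClosed_le (by fun_prop) (by fun_prop)
    exact closure_minimal (fun q hq => hC q hq) hclosed hp
  rw [← LinearMap.ker_eq_bot, LinearMap.ker_eq_bot']
  rintro ⟨p, hp⟩ (h : p.2 = 0)
  have h1 : ‖p.1‖ ≤ 0 := by simpa [h] using hcl p hp
  exact Subtype.ext (Prod.ext (norm_le_zero_iff.1 h1) h)

/-- The norm `‖v‖_V = ‖∇v‖_{L²(D)}`. -/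
instance [NeZero d] (D : BoundedOpen d) : NormedAddCommGroup (H01 D) :=
  NormedAddCommGroup.induced _ _ (H01.grad D) (H01.grad_injective D)

instance [NeZero d] (D : BoundedOpen d) : NormedSpace ℝ (H01 D) :=
  NormedSpace.induced ℝ _ _ (H01.grad D)

theorem H01.norm_def [NeZero d] {D : BoundedOpen d} (v : H01 D) : ‖v‖ = ‖H01.grad D v‖ := rfl

/-! ### The parametric diffusion problem -/

/-- The parameter domain `U = [-1/2, 1/2]^ℕ`. -/
def U : Set (ℕ → ℝ) := {y | ∀ j, y j ∈ Icc (-(1 / 2) : ℝ) (1 / 2)}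

/-- The diffusion coefficient `a(x, y) = a₀(x) + ∑_j y_j ψ_j(x)`. -/
def coeff (a₀ : EuclideanSpace ℝ (Fin d) → ℝ) (ψ : ℕ → EuclideanSpace ℝ (Fin d) → ℝ)
    (x : EuclideanSpace ℝ (Fin d)) (y : ℕ → ℝ) : ℝ :=
  a₀ x + ∑' j, y j * ψ j x

/-- The bilinear form `A(y; w, v) = ∫_D a(x, y) ∇w(x) · ∇v(x) dx`. -/
def bilin (D : BoundedOpen d) (a₀ : EuclideanSpace ℝ (Fin d) → ℝ)
    (ψ : ℕ → EuclideanSpace ℝ (Fin d) → ℝ) (y : ℕ → ℝ) (w v : H01 D) : ℝ :=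
  ∫ x, coeff a₀ ψ x y * inner ℝ (H01.grad D w x) (H01.grad D v x) ∂D.vol

/-- `w ∈ V` solves the weak problem `A(y; w, v) = ⟨f, v⟩` for all `v ∈ V`. -/
def IsWeakSolution [NeZero d] (D : BoundedOpen d) (a₀ : EuclideanSpace ℝ (Fin d) → ℝ)
    (ψ : ℕ → EuclideanSpace ℝ (Fin d) → ℝ) (f : StrongDual ℝ (H01 D)) (y : ℕ → ℝ)
    (w : H01 D) : Prop :=
  ∀ v : H01 D, bilin D a₀ ψ y w v = f v

/-- `‖ ∑_{j ∈ S} (|ψ_j| / b_j) / (2 a₀) ‖_{L^∞(D)}`, as an element of `[0, ∞]`. -/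
def relNorm (D : BoundedOpen d) (a₀ : EuclideanSpace ℝ (Fin d) → ℝ)
    (ψ : ℕ → EuclideanSpace ℝ (Fin d) → ℝ) (b : ℕ → ℝ) (S : Set ℕ) : ℝ≥0∞ :=
  essSup (fun x => ∑' j : S, ENNReal.ofReal (|ψ j x| / b j / (2 * a₀ x))) D.vol

/-! ### Multi-indices and mixed derivatives -/

/-- The multi-indices `ν ∈ {0,1}^ℕ` of finite support. -/
def F₁ : Set (ℕ →₀ ℕ) := {ν | ∀ j, ν j ≤ 1}

/-- `κ̃(ν) = ‖ ∑_{j ∈ supp ν} (|ψ_j| / b_j) / (2 a₀) ‖_{L^∞(D)}`. -/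
def kappaTilde (D : BoundedOpen d) (a₀ : EuclideanSpace ℝ (Fin d) → ℝ)
    (ψ : ℕ → EuclideanSpace ℝ (Fin d) → ℝ) (b : ℕ → ℝ) (ν : ℕ →₀ ℕ) : ℝ≥0∞ :=
  relNorm D a₀ ψ b ν.support

/-- `κ = ‖ ∑_{j ≥ 1} (|ψ_j| / b_j) / (2 a₀) ‖_{L^∞(D)}`. -/
def kappa (D : BoundedOpen d) (a₀ : EuclideanSpace ℝ (Fin d) → ℝ)
    (ψ : ℕ → EuclideanSpace ℝ (Fin d) → ℝ) (b : ℕ → ℝ) : ℝ≥0∞ :=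
  relNorm D a₀ ψ b univ

/-- `κ(k) = sup {κ̃(ν) : ν ∈ F₁, |ν| = k}`. -/
def kappaOrder (D : BoundedOpen d) (a₀ : EuclideanSpace ℝ (Fin d) → ℝ)
    (ψ : ℕ → EuclideanSpace ℝ (Fin d) → ℝ) (b : ℕ → ℝ) (k : ℕ) : ℝ≥0∞ :=
  ⨆ ν ∈ {ν : ℕ →₀ ℕ | ν ∈ F₁ ∧ ν.degree = k}, kappaTilde D a₀ ψ b ν

/-- The partial derivative `∂g/∂y_j` on `U` (one-sided where `y_j = ±1/2`). -/
def partialDeriv [NeZero d] {D : BoundedOpen d} (j : ℕ) (g : (ℕ → ℝ) → H01 D) :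
    (ℕ → ℝ) → H01 D :=
  fun y => derivWithin (fun t => g (Function.update y j t)) (Icc (-(1 / 2)) (1 / 2)) (y j)

/-- The mixed derivative `∂^ν g = ∂^{|ν|} g / (∂y_1^{ν_1} ∂y_2^{ν_2} ⋯)`. -/
def mixedDeriv [NeZero d] {D : BoundedOpen d} (ν : ℕ →₀ ℕ) (g : (ℕ → ℝ) → H01 D) :
    (ℕ → ℝ) → H01 D :=
  ((Finsupp.toMultiset ν).sort (· ≤ ·)).foldr partialDeriv g

end ParametricPDE

end

open ParametricPDE

/-! By Riesz, the weak problem reads `A y w = F` in the Hilbert space `H01 D`. Since `|y_j| ≤ 1/2`,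
the fluctuation of the coefficient is at most `κbar * a₀`, so `a ≥ (1 - κbar) a₀` and `A y` is
coercive, hence invertible. Along each coordinate `A` is affine with slope `B j`, so `u = A⁻¹ F` can
be differentiated, and its derivatives `w_S` over finite index sets `S` satisfy `A w_S = -∑_{j ∈ S}
B_j w_{S \ {j}}` for nonempty `S` (`hasDerivWithinAt_solutionDeriv`).

Estimating each `w_S` separately from this recursion would produce a factorial. Instead, normalise
`g_S = w_S / b^S` and let `E(S) = ∫ a |∇g_S|²` and `c_j(T) = ∫ (|ψ_j| / b_j) |∇g_T|²`. Testing with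
`g_S` and applying Young's inequality with weight `Q` gives `2 E(S) ≤ Q ∑_{j ∈ S} c_j(S \ {j}) + Q⁻¹
∑_{j ∈ S} c_j(S)`. If `∑_{j ∈ S₀} |ψ_j| / b_j ≤ Q a`, the last term is at most `E(S)` and is
absorbed. Summing over all `S ⊆ S₀` with `|S| = k + 1` and regrouping by `T = S \ {j}`, the same
pointwise bound shows that the total energy at level `k + 1` is at most `Q²` times that at level `k`
(`sum_powersetCard_succ_le`). The top level contains only `S₀`, so `E(S₀) ≤ Q^{2|S₀|} E(∅)`.
Coercivity turns this into the norm bound, with `Q` tending to `2κ(|ν|) / (1 - κbar)`. -/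

namespace ParametricPDE

/-! ### Bilinear forms of gradients with a bounded weight -/

section WeightedForm

variable {d : ℕ} {D : BoundedOpen d}

/-- The form `∫_D g ∇w · ∇v dx`. -/
noncomputable def weightedForm (D : BoundedOpen d) (g : EuclideanSpace ℝ (Fin d) → ℝ)
    (w v : H01 D) : ℝ :=
  ∫ x, g x * inner ℝ (H01.grad D w x) (H01.grad D v x) ∂D.vol

variable {g : EuclideanSpace ℝ (Fin d) → ℝ} {C : ℝ}

theorem integrable_weight_mul_inner (hg : AEStronglyMeasurable g D.vol)
    (hC : ∀ᵐ x ∂D.vol, |g x| ≤ C) (w v : H01 D) :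
    Integrable (fun x => g x * inner ℝ (H01.grad D w x) (H01.grad D v x)) D.vol :=
  (L2.integrable_inner (H01.grad D w) (H01.grad D v)).bdd_mul hg hC

theorem weightedForm_comm (w v : H01 D) : weightedForm D g w v = weightedForm D g v w := by
  simp only [weightedForm, real_inner_comm]

theorem weightedForm_add_left (hg : AEStronglyMeasurable g D.vol)
    (hC : ∀ᵐ x ∂D.vol, |g x| ≤ C) (w w' v : H01 D) :
    weightedForm D g (w + w') v = weightedForm D g w v + weightedForm D g w' v := by
  rw [weightedForm, weightedForm, weightedForm, ← integral_add
    (integrable_weight_mul_inner hg hC w v) (integrable_weight_mul_inner hg hC w' v)]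
  refine integral_congr_ae ?_
  filter_upwards [Lp.coeFn_add (H01.grad D w) (H01.grad D w')] with x hx
  rw [map_add, hx, Pi.add_apply, inner_add_left, mul_add]

theorem weightedForm_smul_left (c : ℝ) (w v : H01 D) :
    weightedForm D g (c • w) v = c * weightedForm D g w v := by
  rw [weightedForm, weightedForm, ← integral_const_mul]
  refine integral_congr_ae ?_
  filter_upwards [Lp.coeFn_smul c (H01.grad D w)] with x hx
  rw [map_smul, hx, Pi.smul_apply, real_inner_smul_left]
  ring

theorem weightedForm_self_eq (w : H01 D) :
    weightedForm D g w w = ∫ x, g x * ‖H01.grad D w x‖ ^ 2 ∂D.vol := by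
  simp only [weightedForm, real_inner_self_eq_norm_sq]

theorem integrable_weight_mul_norm_sq (hg : AEStronglyMeasurable g D.vol)
    (hC : ∀ᵐ x ∂D.vol, |g x| ≤ C) (w : H01 D) :
    Integrable (fun x => g x * ‖H01.grad D w x‖ ^ 2) D.vol := by
  simpa only [real_inner_self_eq_norm_sq] using integrable_weight_mul_inner hg hC w w

/-- Young's inequality for a signed weight. -/
theorem abs_weightedForm_le_young (hg : AEStronglyMeasurable g D.vol)
    (hC : ∀ᵐ x ∂D.vol, |g x| ≤ C) {Q : ℝ} (hQ : 0 < Q) (w v : H01 D) :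
    2 * |weightedForm D g w v| ≤
      Q * weightedForm D (fun x => |g x|) w w + Q⁻¹ * weightedForm D (fun x => |g x|) v v := by
  have hg' : AEStronglyMeasurable (fun x => |g x|) D.vol := hg.norm
  have hC' : ∀ᵐ x ∂D.vol, |(|g x|)| ≤ C := by simpa only [abs_abs] using hC
  have i1 := (integrable_weight_mul_norm_sq hg' hC' w).const_mul Q
  have i2 := (integrable_weight_mul_norm_sq hg' hC' v).const_mul Q⁻¹
  rw [weightedForm_self_eq, weightedForm_self_eq, ← integral_const_mul, ← integral_const_mul,
    ← integral_add i1 i2, ← abs_of_pos (two_pos (α := ℝ)), ← abs_mul, weightedForm,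
    ← integral_const_mul, ← Real.norm_eq_abs]
  refine norm_integral_le_of_norm_le (i1.add i2) (Filter.Eventually.of_forall fun x => ?_)
  rw [Real.norm_eq_abs, abs_mul, abs_mul, abs_two]
  have h1 := abs_real_inner_le_norm (H01.grad D w x) (H01.grad D v x)
  set p := ‖H01.grad D w x‖
  set r := ‖H01.grad D v x‖
  have h2 : 2 * (p * r) ≤ Q * p ^ 2 + Q⁻¹ * r ^ 2 := by
    have h3 : 0 ≤ Q⁻¹ * (Q * p - r) ^ 2 := by positivity
    have h4 : Q⁻¹ * (Q * p - r) ^ 2 = Q * p ^ 2 + Q⁻¹ * r ^ 2 - 2 * (p * r) := by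
      field_simp
      ring
    linarith
  have h5 := mul_le_mul_of_nonneg_left h1 (abs_nonneg (g x))
  have h6 := mul_le_mul_of_nonneg_left h2 (abs_nonneg (g x))
  show _ ≤ Q * (|g x| * p ^ 2) + Q⁻¹ * (|g x| * r ^ 2)
  linarith

end WeightedForm

/-! ### Hilbert space structure on `H01 D` and Riesz representation -/

section HilbertStructure

variable {d : ℕ} [NeZero d] {D : BoundedOpen d}

/-- The inner product `⟨∇v, ∇w⟩_{L²(D)}` inducing the norm of `H₀¹(D)`. -/
noncomputable instance : InnerProductSpace ℝ (H01 D) where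
  inner v w := inner ℝ (H01.grad D v) (H01.grad D w)
  norm_sq_eq_re_inner v := by
    rw [H01.norm_def]
    exact norm_sq_eq_re_inner (𝕜 := ℝ) _
  conj_inner_symm v w := inner_conj_symm _ _
  add_left u v w := by rw [map_add, inner_add_left]
  smul_left v w r := by rw [map_smul, inner_smul_left]

theorem H01.poincare (D : BoundedOpen d) :
    ∃ C : ℝ, ∀ v : H01 D, ‖H01.toL2 D v‖ ≤ C * ‖v‖ := by
  obtain ⟨C, hC⟩ := poincare_test D
  refine ⟨C, fun v => ?_⟩
  have hclosed : IsClosed {p : Lp ℝ 2 D.vol × Lp (EuclideanSpace ℝ (Fin d)) 2 D.vol |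
      ‖p.1‖ ≤ C * ‖p.2‖} := isClosed_le (by fun_prop) (by fun_prop)
  exact closure_minimal (fun q hq => hC q hq) hclosed v.2

/-- The norm controls only the gradient; by Poincaré the `L²` parts of a Cauchy sequence are Cauchy
too, and the limit pair stays in the closed graph. -/
instance : CompleteSpace (H01 D) := by
  obtain ⟨C, hC⟩ := H01.poincare D
  let L : H01 D →L[ℝ] Lp ℝ 2 D.vol := (H01.toL2 D).mkContinuous C hC
  let G : H01 D →L[ℝ] Lp (EuclideanSpace ℝ (Fin d)) 2 D.vol :=
    (H01.grad D).mkContinuous 1 fun v => by rw [one_mul, H01.norm_def]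
  refine Metric.complete_of_cauchySeq_tendsto fun s hs => ?_
  obtain ⟨p, hp⟩ := cauchySeq_tendsto_of_complete (L.uniformContinuous.comp_cauchySeq hs)
  obtain ⟨q, hq⟩ := cauchySeq_tendsto_of_complete (G.uniformContinuous.comp_cauchySeq hs)
  have hmem : (p, q) ∈ (testGraph D).topologicalClosure := by
    refine (testGraph D).isClosed_topologicalClosure.mem_of_tendsto (hp.prodMk_nhds hq)
      (Filter.Eventually.of_forall fun n => ?_)
    exact (s n).2
  let l : H01 D := ⟨(p, q), hmem⟩
  refine ⟨l, tendsto_iff_norm_sub_tendsto_zero.2 ?_⟩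
  refine (tendsto_iff_norm_sub_tendsto_zero.1 hq).congr fun n => ?_
  rw [H01.norm_def, map_sub]
  rfl

variable {g : EuclideanSpace ℝ (Fin d) → ℝ} {C : ℝ}

theorem abs_weightedForm_le (hC0 : 0 ≤ C) (hC : ∀ᵐ x ∂D.vol, |g x| ≤ C)
    (w v : H01 D) : |weightedForm D g w v| ≤ C * ‖w‖ * ‖v‖ := by
  have hw := Lp.memLp (H01.grad D w)
  have hv := Lp.memLp (H01.grad D v)
  have hi : Integrable (fun x => ‖H01.grad D w x‖ * ‖H01.grad D v x‖) D.vol :=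
    hw.norm.integrable_mul hv.norm
  have h1 : |weightedForm D g w v| ≤ ∫ x, C * (‖H01.grad D w x‖ * ‖H01.grad D v x‖) ∂D.vol := by
    rw [weightedForm, ← Real.norm_eq_abs]
    refine norm_integral_le_of_norm_le (hi.const_mul C) ?_
    filter_upwards [hC] with x hx
    rw [norm_mul]
    exact mul_le_mul hx (norm_inner_le_norm _ _) (norm_nonneg _) hC0
  refine h1.trans ?_
  rw [integral_const_mul, mul_assoc]
  refine mul_le_mul_of_nonneg_left ?_ hC0
  have h2 : ∫ x, ‖H01.grad D w x‖ * ‖H01.grad D v x‖ ∂D.vol =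
      inner ℝ (hw.norm.toLp _) (hv.norm.toLp _) := by
    rw [L2.inner_def]
    refine integral_congr_ae ?_
    filter_upwards [hw.norm.coeFn_toLp, hv.norm.coeFn_toLp] with x hx hx'
    rw [hx, hx']
    simp [mul_comm]
  rw [h2]
  refine (real_inner_le_norm _ _).trans_eq ?_
  rw [H01.norm_def, H01.norm_def, Lp.norm_toLp, Lp.norm_toLp, eLpNorm_norm, eLpNorm_norm,
    Lp.norm_def, Lp.norm_def]

/-- Riesz representation of the form with a bounded weight. -/
theorem exists_operator_weightedForm (hg : AEStronglyMeasurable g D.vol)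
    (hC : ∀ᵐ x ∂D.vol, |g x| ≤ C) :
    ∃ T : H01 D →L[ℝ] H01 D, ∀ w v, inner ℝ (T w) v = weightedForm D g w v := by
  let β : H01 D →ₗ[ℝ] H01 D →ₗ[ℝ] ℝ := LinearMap.mk₂ ℝ (weightedForm D g)
    (fun w w' v => weightedForm_add_left hg hC w w' v)
    (fun c w v => by rw [weightedForm_smul_left, smul_eq_mul])
    (fun w v v' => by
      rw [weightedForm_comm, weightedForm_add_left hg hC, weightedForm_comm v,
        weightedForm_comm v'])
    (fun c w v => by
      rw [weightedForm_comm, weightedForm_smul_left, weightedForm_comm, smul_eq_mul])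
  -- The absolute value is needed because `C` may be negative when `D` is a null set.
  refine ⟨InnerProductSpace.continuousLinearMapOfBilin (𝕜 := ℝ)
    (β.mkContinuous₂ |C| fun w v =>
      abs_weightedForm_le (abs_nonneg C) (hC.mono fun x hx => hx.trans (le_abs_self C)) w v), fun w v => ?_⟩
  rw [InnerProductSpace.continuousLinearMapOfBilin_apply]
  rfl

theorem mul_norm_sq_le_weightedForm (hg : AEStronglyMeasurable g D.vol)
    (hC : ∀ᵐ x ∂D.vol, |g x| ≤ C) {α : ℝ} (hα : ∀ᵐ x ∂D.vol, α ≤ g x) (w : H01 D) :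
    α * ‖w‖ ^ 2 ≤ weightedForm D g w w := by
  rw [H01.norm_def, ← real_inner_self_eq_norm_sq, L2.inner_def, weightedForm,
    ← integral_const_mul]
  refine integral_mono_ae ((L2.integrable_inner _ _).const_mul α)
    (integrable_weight_mul_inner hg hC w w) ?_
  filter_upwards [hα] with x hx
  exact mul_le_mul_of_nonneg_right hx real_inner_self_nonneg

end HilbertStructure

/-! ### Derivatives of the solution of an affinely parametrised equation -/

section AffineFamily

variable {H : Type*} [NormedAddCommGroup H] [NormedSpace ℝ H]

/-- The mixed first-order derivatives of the solution `y ↦ A(y)⁻¹ F` of an equation with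
`∂A/∂y_j = B_j`, by the recursion `A(y) w_S = -∑_{j ∈ S} B_j w_{S \ {j}}`. -/
noncomputable def solutionDeriv (A : (ℕ → ℝ) → H →L[ℝ] H) (B : ℕ → H →L[ℝ] H) (F : H)
    (S : Finset ℕ) (y : ℕ → ℝ) : H :=
  Ring.inverse (A y) ((if S = ∅ then F else 0) -
    ∑ j ∈ S.attach, B j (solutionDeriv A B F (S.erase j) y))
termination_by S.card
decreasing_by exact Finset.card_erase_lt_of_mem j.2

variable {A : (ℕ → ℝ) → H →L[ℝ] H} {B : ℕ → H →L[ℝ] H} {F : H}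

theorem solutionDeriv_eq (S : Finset ℕ) (y : ℕ → ℝ) :
    solutionDeriv A B F S y = Ring.inverse (A y) ((if S = ∅ then F else 0) -
      ∑ j ∈ S, B j (solutionDeriv A B F (S.erase j) y)) := by
  rw [solutionDeriv, Finset.sum_attach S fun j => B j (solutionDeriv A B F (S.erase j) y)]

theorem apply_solutionDeriv {y : ℕ → ℝ} (hA : IsUnit (A y)) (S : Finset ℕ) :
    A y (solutionDeriv A B F S y) = (if S = ∅ then F else 0) -
      ∑ j ∈ S, B j (solutionDeriv A B F (S.erase j) y) := by
  rw [solutionDeriv_eq, ← mul_apply_eq_comp, Ring.mul_inverse_cancel _ hA,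
    one_apply_eq_self]

theorem update_mem_U {y : ℕ → ℝ} (hy : y ∈ U) (j : ℕ) {t : ℝ}
    (ht : t ∈ Icc (-(1 / 2) : ℝ) (1 / 2)) : Function.update y j t ∈ U := by
  intro i
  rcases eq_or_ne i j with rfl | h
  · simpa using ht
  · simpa [Function.update_of_ne h] using hy i

theorem hasDerivWithinAt_inverse_update [CompleteSpace H] (hA : ∀ y ∈ U, IsUnit (A y))
    (hAB : ∀ y ∈ U, ∀ j, ∀ t ∈ Icc (-(1 / 2) : ℝ) (1 / 2),
      A (Function.update y j t) = A y + (t - y j) • B j)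
    {y : ℕ → ℝ} (hy : y ∈ U) (j : ℕ) :
    HasDerivWithinAt (fun t => Ring.inverse (A (Function.update y j t)))
      (-(Ring.inverse (A y) * B j * Ring.inverse (A y))) (Icc (-(1 / 2)) (1 / 2)) (y j) := by
  have h1 : HasDerivAt (fun t : ℝ => A y + (t - y j) • B j) (B j) (y j) := by
    simpa using (((hasDerivAt_id (y j)).sub_const (y j)).smul_const (B j)).const_add (A y)
  obtain ⟨x, hx⟩ := hA y hy
  have h2 := hasFDerivAt_ringInverse (𝕜 := ℝ) x
  have h3 : HasDerivAt (fun t : ℝ => Ring.inverse (A y + (t - y j) • B j))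
      (-(Ring.inverse (A y) * B j * Ring.inverse (A y))) (y j) := by
    have h4 := HasFDerivAt.comp_hasDerivAt_of_eq (y j) h2 h1 (by simp [hx])
    rw [← hx, Ring.inverse_unit]
    rw [← hx] at h4
    simpa using! h4
  exact h3.hasDerivWithinAt.congr (fun t ht => by rw [hAB y hy j t ht])
    (by rw [hAB y hy j _ (hy j)])

/-- Product rule for `A⁻¹` applied to the right-hand side of the recursion. Differentiating `A⁻¹`
gives `-A⁻¹ B_j w_S`, the term with index `j` in the recursion for `insert j S`; differentiating the
right-hand side gives the terms with index in `S`, by induction on `S`. -/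
theorem hasDerivWithinAt_solutionDeriv [CompleteSpace H] (hA : ∀ y ∈ U, IsUnit (A y))
    (hAB : ∀ y ∈ U, ∀ j, ∀ t ∈ Icc (-(1 / 2) : ℝ) (1 / 2),
      A (Function.update y j t) = A y + (t - y j) • B j)
    {y : ℕ → ℝ} (hy : y ∈ U) {j : ℕ} (S : Finset ℕ) (hj : j ∉ S) :
    HasDerivWithinAt (fun t => solutionDeriv A B F S (Function.update y j t))
      (solutionDeriv A B F (insert j S) y) (Icc (-(1 / 2)) (1 / 2)) (y j) := by
  induction S using Finset.strongInduction with
  | H S ih =>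
    have hsum : HasDerivWithinAt
        (fun t => (if S = ∅ then F else 0) -
          ∑ i ∈ S, B i (solutionDeriv A B F (S.erase i) (Function.update y j t)))
        (-∑ i ∈ S, B i (solutionDeriv A B F (insert j (S.erase i)) y))
        (Icc (-(1 / 2)) (1 / 2)) (y j) := by
      refine HasDerivWithinAt.const_sub _ (HasDerivWithinAt.fun_sum fun i hi => ?_)
      exact (B i).hasFDerivAt.comp_hasDerivWithinAt (y j)
        (ih _ (Finset.erase_ssubset hi) fun h => hj (Finset.mem_of_mem_erase h))
    have h := (hasDerivWithinAt_inverse_update hA hAB hy j).clm_apply hsum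
    have hfun : (fun t => solutionDeriv A B F S (Function.update y j t)) = fun t =>
        Ring.inverse (A (Function.update y j t)) ((if S = ∅ then F else 0) -
          ∑ i ∈ S, B i (solutionDeriv A B F (S.erase i) (Function.update y j t))) :=
      funext fun t => solutionDeriv_eq S _
    rw [hfun]
    refine h.congr_deriv ?_
    rw [solutionDeriv_eq (insert j S), if_neg (Finset.insert_ne_empty j S),
      Finset.sum_insert hj, Finset.erase_insert hj]
    have hcomm : ∑ i ∈ S, B i (solutionDeriv A B F ((insert j S).erase i) y) =
        ∑ i ∈ S, B i (solutionDeriv A B F (insert j (S.erase i)) y) := by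
      refine Finset.sum_congr rfl fun i hi => ?_
      rw [Finset.erase_insert_of_ne fun e : j = i => hj (e ▸ hi)]
    rw [hcomm, Function.update_eq_self, neg_apply, mul_apply_eq_comp,
      mul_apply_eq_comp, ← solutionDeriv_eq S y]
    simp only [zero_sub, map_neg, neg_add, map_add]

end AffineFamily

/-! ### The combinatorial energy recursion -/

section EnergyEstimate

open Finset

variable {S₀ : Finset ℕ} {e : Finset ℕ → ℝ} {c : ℕ → Finset ℕ → ℝ} {Q : ℝ}

/-- Summation of the energy recursion over all index sets of a given cardinality. -/
theorem sum_powersetCard_succ_le (hQ : 0 ≤ Q)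
    (hrec : ∀ S ⊆ S₀, S.Nonempty → e S ≤ Q * ∑ j ∈ S, c j (S.erase j))
    (hc : ∀ T ⊆ S₀, ∑ j ∈ S₀ \ T, c j T ≤ Q * e T) (k : ℕ) :
    ∑ S ∈ S₀.powersetCard (k + 1), e S ≤ Q ^ 2 * ∑ T ∈ S₀.powersetCard k, e T := by
  -- Pairs `(S, j)` with `j ∈ S` correspond to pairs `(T, j)` with `j ∉ T` through `T = S \ {j}`.
  have hswap : ∑ S ∈ S₀.powersetCard (k + 1), ∑ j ∈ S, c j (S.erase j) =
      ∑ T ∈ S₀.powersetCard k, ∑ j ∈ S₀ \ T, c j T := by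
    rw [sum_sigma', sum_sigma']
    refine sum_bij' (fun p _ => ⟨p.1.erase p.2, p.2⟩) (fun p _ => ⟨insert p.2 p.1, p.2⟩)
      ?_ ?_ ?_ ?_ ?_
    · rintro ⟨S, j⟩ h
      simp only [mem_sigma, mem_powersetCard, Finset.mem_sdiff] at h ⊢
      refine ⟨⟨(erase_subset _ _).trans h.1.1, ?_⟩, h.1.1 h.2, notMem_erase _ _⟩
      rw [card_erase_of_mem h.2, h.1.2, Nat.add_sub_cancel]
    · rintro ⟨T, j⟩ h
      simp only [mem_sigma, mem_powersetCard, Finset.mem_sdiff] at h ⊢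
      exact ⟨⟨insert_subset h.2.1 h.1.1, by rw [card_insert_of_notMem h.2.2, h.1.2]⟩,
        mem_insert_self _ _⟩
    · rintro ⟨S, j⟩ h
      simp only [mem_sigma] at h
      simp [insert_erase h.2]
    · rintro ⟨T, j⟩ h
      simp only [mem_sigma, Finset.mem_sdiff] at h
      simp [erase_insert h.2.2]
    · rintro ⟨S, j⟩ h
      rfl
  calc ∑ S ∈ S₀.powersetCard (k + 1), e S
      ≤ ∑ S ∈ S₀.powersetCard (k + 1), Q * ∑ j ∈ S, c j (S.erase j) :=
        sum_le_sum fun S hS => hrec S (mem_powersetCard.1 hS).1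
          (card_pos.1 ((mem_powersetCard.1 hS).2 ▸ k.succ_pos))
    _ = Q * ∑ T ∈ S₀.powersetCard k, ∑ j ∈ S₀ \ T, c j T := by rw [← mul_sum, hswap]
    _ ≤ Q * ∑ T ∈ S₀.powersetCard k, Q * e T :=
        mul_le_mul_of_nonneg_left
          (sum_le_sum fun T hT => hc T (mem_powersetCard.1 hT).1) hQ
    _ = Q ^ 2 * ∑ T ∈ S₀.powersetCard k, e T := by rw [← mul_sum]; ring

theorem le_pow_mul_of_recursion (hQ : 0 ≤ Q)
    (hrec : ∀ S ⊆ S₀, S.Nonempty → e S ≤ Q * ∑ j ∈ S, c j (S.erase j))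
    (hc : ∀ T ⊆ S₀, ∑ j ∈ S₀ \ T, c j T ≤ Q * e T) :
    e S₀ ≤ (Q ^ 2) ^ S₀.card * e ∅ := by
  have h : ∀ k, ∑ S ∈ S₀.powersetCard k, e S ≤ (Q ^ 2) ^ k * e ∅ := by
    intro k
    induction k with
    | zero => simp
    | succ k ih =>
      refine (sum_powersetCard_succ_le hQ hrec hc k).trans ?_
      rw [pow_succ' (Q ^ 2), mul_assoc]
      exact mul_le_mul_of_nonneg_left ih (sq_nonneg Q)
  simpa using h S₀.card

end EnergyEstimate

/-! ### Mixed derivatives and multi-indices in `F₁` -/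

section MixedDerivatives

variable {d : ℕ} [NeZero d] {D : BoundedOpen d}
  {A : (ℕ → ℝ) → H01 D →L[ℝ] H01 D} {B : ℕ → H01 D →L[ℝ] H01 D} {F : H01 D}
  {u : (ℕ → ℝ) → H01 D}

/-- The right-hand side depends only on the set of indices, which is why the order of
differentiation is immaterial. Equality on all of `U` is what lets the induction differentiate
again. -/
theorem foldr_partialDeriv_eq_solutionDeriv (hA : ∀ y ∈ U, IsUnit (A y))
    (hAB : ∀ y ∈ U, ∀ j, ∀ t ∈ Icc (-(1 / 2) : ℝ) (1 / 2),
      A (Function.update y j t) = A y + (t - y j) • B j)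
    (hu : ∀ y ∈ U, u y = solutionDeriv A B F ∅ y) (l : List ℕ) (hl : l.Nodup) :
    ∀ y ∈ U, l.foldr partialDeriv u y = solutionDeriv A B F l.toFinset y := by
  induction l with
  | nil => simpa using hu
  | cons j l ih =>
    intro y hy
    rw [List.nodup_cons] at hl
    have h := (hasDerivWithinAt_solutionDeriv (F := F) hA hAB hy l.toFinset
      (by simpa using hl.1)).congr
      (fun t ht => ih hl.2 _ (update_mem_U hy j ht)) (ih hl.2 _ (update_mem_U hy j (hy j)))
    rw [List.toFinset_cons]
    exact h.derivWithin (uniqueDiffOn_Icc (by norm_num) _ (hy j))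

theorem mixedDeriv_eq_solutionDeriv (hA : ∀ y ∈ U, IsUnit (A y))
    (hAB : ∀ y ∈ U, ∀ j, ∀ t ∈ Icc (-(1 / 2) : ℝ) (1 / 2),
      A (Function.update y j t) = A y + (t - y j) • B j)
    (hu : ∀ y ∈ U, u y = solutionDeriv A B F ∅ y) {ν : ℕ →₀ ℕ} (hν : ν ∈ F₁)
    {y : ℕ → ℝ} (hy : y ∈ U) :
    mixedDeriv ν u y = solutionDeriv A B F ν.support y := by
  have hnd : ((Finsupp.toMultiset ν).sort (· ≤ ·)).Nodup := by
    rw [← Multiset.coe_nodup, Multiset.sort_eq, Multiset.nodup_iff_count_le_one]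
    intro j
    rw [Finsupp.count_toMultiset]
    exact hν j
  rw [mixedDeriv, foldr_partialDeriv_eq_solutionDeriv hA hAB hu _ hnd y hy,
    List.toFinset, Multiset.sort_eq, Finsupp.toFinset_toMultiset]

theorem add_single_mem_F₁ {ν : ℕ →₀ ℕ} (hν : ν ∈ F₁) {j : ℕ} (hj : j ∉ ν.support) :
    ν + Finsupp.single j 1 ∈ F₁ := by
  intro i
  rcases eq_or_ne j i with rfl | h
  · simp [Finsupp.notMem_support_iff.1 hj]
  · simpa [Finsupp.single_eq_of_ne h.symm] using hν i

theorem support_add_single {ν : ℕ →₀ ℕ} (j : ℕ) :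
    (ν + Finsupp.single j 1).support = insert j ν.support := by
  ext i
  rcases eq_or_ne j i with rfl | h
  · simp
  · simp [Finsupp.single_eq_of_ne h.symm, h.symm]

theorem degree_eq_card_support {ν : ℕ →₀ ℕ} (hν : ν ∈ F₁) : ν.degree = ν.support.card := by
  rw [Finsupp.degree_apply, Finset.card_eq_sum_ones]
  refine Finset.sum_congr rfl fun j hj => ?_
  have h1 := hν j
  have h2 := Finsupp.mem_support_iff.1 hj
  omega

theorem prod_pow_eq_prod_support {ν : ℕ →₀ ℕ} (hν : ν ∈ F₁) (b : ℕ → ℝ) :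
    (ν.prod fun j n => b j ^ n) = ∏ j ∈ ν.support, b j := by
  refine Finset.prod_congr rfl fun j hj => ?_
  have h1 := hν j
  have h2 := Finsupp.mem_support_iff.1 hj
  simp [show ν j = 1 by omega]

end MixedDerivatives

/-! ### Energy growth for the family of derivatives -/

section EnergyRecursion

variable {d : ℕ} {D : BoundedOpen d} {a : EuclideanSpace ℝ (Fin d) → ℝ}
  {φ : ℕ → EuclideanSpace ℝ (Fin d) → ℝ} {Ca Q : ℝ} {C : ℕ → ℝ} {S₀ : Finset ℕ}

/-- Needed twice: for `S` itself, to absorb half of Young's inequality, and for `S₀ \ T`, to close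
the recursion. -/
theorem sum_weightedForm_abs_le (ha : AEStronglyMeasurable a D.vol)
    (hCa : ∀ᵐ x ∂D.vol, |a x| ≤ Ca) (hφ : ∀ j, AEStronglyMeasurable (φ j) D.vol)
    (hC : ∀ j, ∀ᵐ x ∂D.vol, |φ j x| ≤ C j)
    (hQ : ∀ᵐ x ∂D.vol, ∑ j ∈ S₀, |φ j x| ≤ Q * a x) {S : Finset ℕ} (hS : S ⊆ S₀) (v : H01 D) :
    ∑ j ∈ S, weightedForm D (fun x => |φ j x|) v v ≤ Q * weightedForm D a v v := by
  have hi : ∀ j ∈ S, Integrable (fun x => |φ j x| * ‖H01.grad D v x‖ ^ 2) D.vol := fun j _ =>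
    integrable_weight_mul_norm_sq (hφ j).norm (by simpa using hC j) v
  simp only [weightedForm_self_eq]
  rw [← integral_finsetSum _ hi, ← integral_const_mul]
  refine integral_mono_ae (integrable_finsetSum _ hi)
    ((integrable_weight_mul_norm_sq ha hCa v).const_mul Q) ?_
  filter_upwards [hQ] with x hx
  rw [← Finset.sum_mul, ← mul_assoc]
  refine mul_le_mul_of_nonneg_right (le_trans ?_ hx) (sq_nonneg _)
  exact Finset.sum_le_sum_of_subset_of_nonneg hS fun j _ _ => abs_nonneg _

/-- The energy of a family solving `(a g_S, ·) = -∑_{j ∈ S} (φ_j g_{S \ {j}}, ·)` grows at most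
geometrically in `|S|`. -/
theorem weightedForm_le_pow_mul (ha : AEStronglyMeasurable a D.vol)
    (hCa : ∀ᵐ x ∂D.vol, |a x| ≤ Ca) (hφ : ∀ j, AEStronglyMeasurable (φ j) D.vol)
    (hC : ∀ j, ∀ᵐ x ∂D.vol, |φ j x| ≤ C j) (hQ0 : 0 < Q)
    (hQ : ∀ᵐ x ∂D.vol, ∑ j ∈ S₀, |φ j x| ≤ Q * a x) (g : Finset ℕ → H01 D)
    (hg : ∀ S, S.Nonempty → weightedForm D a (g S) (g S) =
      -∑ j ∈ S, weightedForm D (φ j) (g (S.erase j)) (g S)) :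
    weightedForm D a (g S₀) (g S₀) ≤ (Q ^ 2) ^ S₀.card * weightedForm D a (g ∅) (g ∅) := by
  refine le_pow_mul_of_recursion (e := fun S => weightedForm D a (g S) (g S))
    (c := fun j T => weightedForm D (fun x => |φ j x|) (g T) (g T)) hQ0.le
    (fun S hS hne => ?_)
    (fun T _ => sum_weightedForm_abs_le ha hCa hφ hC hQ Finset.sdiff_subset (g T))
  have h1 : 2 * weightedForm D a (g S) (g S) ≤
      ∑ j ∈ S, 2 * |weightedForm D (φ j) (g (S.erase j)) (g S)| := by
    rw [hg S hne, ← Finset.mul_sum]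
    exact mul_le_mul_of_nonneg_left
      ((neg_le_abs _).trans (Finset.abs_sum_le_sum_abs _ _)) two_pos.le
  have h2 := h1.trans (Finset.sum_le_sum fun j _ =>
    abs_weightedForm_le_young (hφ j) (hC j) hQ0 (g (S.erase j)) (g S))
  rw [Finset.sum_add_distrib, ← Finset.mul_sum, ← Finset.mul_sum] at h2
  -- The `Q⁻¹` part of Young's inequality is at most the energy of `g S`, one of the two copies on
  -- the left.
  have h3 := mul_le_mul_of_nonneg_left
    (sum_weightedForm_abs_le ha hCa hφ hC hQ hS (g S)) (inv_nonneg.2 hQ0.le)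
  rw [inv_mul_cancel_left₀ hQ0.ne'] at h3
  linarith

theorem weightedForm_div (g : EuclideanSpace ℝ (Fin d) → ℝ) (β : ℝ) (w v : H01 D) :
    weightedForm D (fun x => g x / β) w v = β⁻¹ * weightedForm D g w v := by
  rw [weightedForm, weightedForm, ← integral_const_mul]
  refine integral_congr_ae (Filter.Eventually.of_forall fun x => ?_)
  simp only [div_eq_mul_inv]
  ring

end EnergyRecursion

/-! ### Pointwise bounds on the coefficient; monotonicity of the relative norms -/

section Coefficient

variable {d : ℕ} {D : BoundedOpen d} {a₀ : EuclideanSpace ℝ (Fin d) → ℝ}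
  {ψ : ℕ → EuclideanSpace ℝ (Fin d) → ℝ} {b : ℕ → ℝ}

theorem relNorm_mono {S T : Set ℕ} (h : S ⊆ T) : relNorm D a₀ ψ b S ≤ relNorm D a₀ ψ b T :=
  essSup_mono_ae (Filter.Eventually.of_forall fun x =>
    ENNReal.tsum_mono_subtype (fun j => ENNReal.ofReal (|ψ j x| / b j / (2 * a₀ x))) h)

theorem ae_tsum_le_relNorm (S : Set ℕ) : ∀ᵐ x ∂D.vol,
    ∑' j : S, ENNReal.ofReal (|ψ j x| / b j / (2 * a₀ x)) ≤ relNorm D a₀ ψ b S :=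
  ENNReal.ae_le_essSup _

/-- A finite `ℝ≥0∞`-valued sum forces real summability, so almost everywhere the series in `coeff`
is a genuine sum and not the default value of `tsum`. -/
theorem ae_summable_and_tsum_le {κ : ℝ} (hκ0 : 0 ≤ κ) (ha₀ : ∀ᵐ x ∂D.vol, 0 < a₀ x)
    (hκ : relNorm D a₀ ψ (fun _ => 1) univ ≤ ENNReal.ofReal κ) :
    ∀ᵐ x ∂D.vol, Summable (fun j => |ψ j x|) ∧ ∑' j, |ψ j x| ≤ 2 * κ * a₀ x := by
  filter_upwards [ae_tsum_le_relNorm (D := D) (a₀ := a₀) (ψ := ψ) (b := fun _ => 1) univ, ha₀]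
    with x hx hpos
  have h0 : ∀ j, 0 ≤ |ψ j x| / (2 * a₀ x) := fun j => by positivity
  have hle : ∑' j, ENNReal.ofReal (|ψ j x| / (2 * a₀ x)) ≤ ENNReal.ofReal κ := by
    have := hx.trans hκ
    rw [tsum_univ fun j => ENNReal.ofReal (|ψ j x| / 1 / (2 * a₀ x))] at this
    simpa only [div_one] using this
  have hs : Summable fun j => |ψ j x| / (2 * a₀ x) := by
    have := ENNReal.summable_toReal (hle.trans_lt ENNReal.ofReal_lt_top).ne
    simpa only [ENNReal.toReal_ofReal (h0 _)] using this
  rw [← ENNReal.ofReal_tsum_of_nonneg h0 hs, ENNReal.ofReal_le_ofReal_iff hκ0] at hle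
  have hs' : Summable fun j => |ψ j x| := by
    refine (hs.mul_right (2 * a₀ x)).congr fun j => ?_
    field_simp
  refine ⟨hs', ?_⟩
  rw [tsum_div_const, div_le_iff₀ (by positivity)] at hle
  linarith

theorem ae_finset_sum_le (hb : ∀ j, 0 < b j) (ha₀ : ∀ᵐ x ∂D.vol, 0 < a₀ x) (S : Finset ℕ)
    {κ : ℝ} (hκ0 : 0 ≤ κ) (hκ : relNorm D a₀ ψ b S ≤ ENNReal.ofReal κ) :
    ∀ᵐ x ∂D.vol, ∑ j ∈ S, |ψ j x / b j| ≤ 2 * κ * a₀ x := by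
  filter_upwards [ae_tsum_le_relNorm (D := D) (a₀ := a₀) (ψ := ψ) (b := b) S, ha₀] with x hx hpos
  have h0 : ∀ j ∈ S, 0 ≤ |ψ j x| / b j / (2 * a₀ x) := fun j _ => by
    have := hb j
    positivity
  have hle := hx.trans hκ
  rw [Finset.tsum_subtype' S fun j => ENNReal.ofReal (|ψ j x| / b j / (2 * a₀ x)),
    ← ENNReal.ofReal_sum_of_nonneg h0, ENNReal.ofReal_le_ofReal_iff hκ0, ← Finset.sum_div,
    div_le_iff₀ (by positivity)] at hle
  have e : ∑ j ∈ S, |ψ j x / b j| = ∑ j ∈ S, |ψ j x| / b j :=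
    Finset.sum_congr rfl fun j _ => by rw [abs_div, abs_of_pos (hb j)]
  rw [e]
  linarith

theorem summable_parametric {x : EuclideanSpace ℝ (Fin d)} (hs : Summable fun j => |ψ j x|)
    {y : ℕ → ℝ} (hy : y ∈ U) : Summable fun j => y j * ψ j x := by
  refine Summable.of_norm_bounded hs fun j => ?_
  rw [Real.norm_eq_abs, abs_mul]
  have h := abs_le.2 (hy j)
  have h' := abs_nonneg (ψ j x)
  nlinarith

theorem abs_tsum_parametric_le {x : EuclideanSpace ℝ (Fin d)}
    (hs : Summable fun j => |ψ j x|) {y : ℕ → ℝ} (hy : y ∈ U) :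
    |∑' j, y j * ψ j x| ≤ (∑' j, |ψ j x|) / 2 := by
  rw [← tsum_div_const, ← Real.norm_eq_abs]
  refine tsum_of_norm_bounded (hs.div_const 2).hasSum fun j => ?_
  rw [Real.norm_eq_abs, abs_mul]
  have h := abs_le.2 (hy j)
  have h' := abs_nonneg (ψ j x)
  nlinarith

theorem coeff_update {x : EuclideanSpace ℝ (Fin d)} (hs : Summable fun j => |ψ j x|)
    {y : ℕ → ℝ} (hy : y ∈ U) (j : ℕ) (t : ℝ) :
    coeff a₀ ψ x (Function.update y j t) = coeff a₀ ψ x y + (t - y j) * ψ j x := by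
  have h := (summable_parametric hs hy).hasSum.update j (t * ψ j x)
  have e : Function.update (fun i => y i * ψ i x) j (t * ψ j x) =
      fun i => Function.update y j t i * ψ i x := by
    funext i
    rcases eq_or_ne i j with rfl | hij
    · simp
    · simp [Function.update_of_ne hij]
  rw [e] at h
  rw [coeff, coeff, h.tsum_eq]
  ring

theorem aestronglyMeasurable_coeff (ha₀ : AEStronglyMeasurable a₀ D.vol)
    (hψ : ∀ j, AEStronglyMeasurable (ψ j) D.vol)
    (hs : ∀ᵐ x ∂D.vol, Summable fun j => |ψ j x|) {y : ℕ → ℝ} (hy : y ∈ U) :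
    AEStronglyMeasurable (fun x => coeff a₀ ψ x y) D.vol := by
  refine ha₀.add (aestronglyMeasurable_of_tendsto_ae Filter.atTop
    (f := fun n x => ∑ j ∈ Finset.range n, y j * ψ j x) (fun n => ?_) ?_)
  · exact Finset.aestronglyMeasurable_fun_sum _ fun j _ => (hψ j).const_mul (y j)
  · filter_upwards [hs] with x hx
    exact (summable_parametric hx hy).hasSum.tendsto_sum_nat

end Coefficient

theorem kappaTilde_le_kappaOrder {d : ℕ} (D : BoundedOpen d)
    (a₀ : EuclideanSpace ℝ (Fin d) → ℝ) (ψ : ℕ → EuclideanSpace ℝ (Fin d) → ℝ) (b : ℕ → ℝ)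
    {ν : ℕ →₀ ℕ} (hν : ν ∈ F₁) : kappaTilde D a₀ ψ b ν ≤ kappaOrder D a₀ ψ b ν.degree :=
  le_iSup₂_of_le (f := fun ν _ => kappaTilde D a₀ ψ b ν) ν ⟨hν, rfl⟩ le_rfl

theorem kappaOrder_le_kappa {d : ℕ} (D : BoundedOpen d)
    (a₀ : EuclideanSpace ℝ (Fin d) → ℝ) (ψ : ℕ → EuclideanSpace ℝ (Fin d) → ℝ) (b : ℕ → ℝ)
    (k : ℕ) : kappaOrder D a₀ ψ b k ≤ kappa D a₀ ψ b :=
  iSup₂_le fun _ _ => relNorm_mono (subset_univ _)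

/-! ### From energies to the norm bound -/

section EnergyBound

variable {d : ℕ} [NeZero d] {D : BoundedOpen d} {a : EuclideanSpace ℝ (Fin d) → ℝ}
  {φ : ℕ → EuclideanSpace ℝ (Fin d) → ℝ} {α Ca q : ℝ} {C : ℕ → ℝ}

/-- Testing with `w` bounds the energy by `‖f‖ ‖w‖`, and coercivity gives `α ‖w‖ ≤ ‖f‖`. Bounding
the energy directly keeps the upper bound of `a` out of the final constant. -/
theorem weightedForm_self_le_of_forall_eq (ha : AEStronglyMeasurable a D.vol)
    (hCa : ∀ᵐ x ∂D.vol, |a x| ≤ Ca) (hα0 : 0 < α) (hα : ∀ᵐ x ∂D.vol, α ≤ a x)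
    (f : StrongDual ℝ (H01 D)) {w : H01 D} (hw : ∀ v, weightedForm D a w v = f v) :
    weightedForm D a w w ≤ ‖f‖ ^ 2 / α := by
  have h1 := mul_norm_sq_le_weightedForm ha hCa hα w
  have h2 : weightedForm D a w w ≤ ‖f‖ * ‖w‖ := by
    rw [hw]
    exact (le_abs_self _).trans (f.le_opNorm w)
  rw [le_div_iff₀ hα0]
  have h3 := sq_nonneg (‖f‖ - α * ‖w‖)
  have h4 : α * ‖w‖ ≤ ‖f‖ := by
    by_contra! h
    rcases (norm_nonneg w).eq_or_lt with h0 | h0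
    · rw [← h0, mul_zero] at h
      exact absurd h (norm_nonneg f).not_gt
    · nlinarith
  nlinarith [mul_le_mul_of_nonneg_left h2 hα0.le, norm_nonneg f]

/-- The norm bound for `w_∅ = w` solving `(a w, ·) = f` and
`(a w_S, ·) = -∑_{j ∈ S} (ψ_j w_{S \ {j}}, ·)`. -/
theorem norm_le_prod_mul_pow_mul (ha : AEStronglyMeasurable a D.vol)
    (hCa : ∀ᵐ x ∂D.vol, |a x| ≤ Ca) (hα0 : 0 < α) (hα : ∀ᵐ x ∂D.vol, α ≤ a x)
    (hφ : ∀ j, AEStronglyMeasurable (φ j) D.vol)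
    (hC : ∀ j, ∀ᵐ x ∂D.vol, |φ j x| ≤ C j) {b : ℕ → ℝ} (hb : ∀ j, 0 < b j) (hq0 : 0 ≤ q)
    {S₀ : Finset ℕ} (hq : ∀ᵐ x ∂D.vol, ∑ j ∈ S₀, |φ j x / b j| ≤ q * a x)
    (f : StrongDual ℝ (H01 D)) (w : Finset ℕ → H01 D)
    (hw0 : ∀ v, weightedForm D a (w ∅) v = f v)
    (hw : ∀ S, S.Nonempty → ∀ v, weightedForm D a (w S) v =
      -∑ j ∈ S, weightedForm D (φ j) (w (S.erase j)) v) :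
    ‖w S₀‖ ≤ (∏ j ∈ S₀, b j) * q ^ S₀.card * (‖f‖ / α) := by
  set β : Finset ℕ → ℝ := fun S => ∏ j ∈ S, b j with hβ
  have hβ0 : ∀ S, 0 < β S := fun S => Finset.prod_pos fun j _ => hb j
  have hφ' : ∀ j, AEStronglyMeasurable (fun x => φ j x / b j) D.vol := fun j =>
    ((hφ j).const_mul (b j)⁻¹).congr
      (Filter.Eventually.of_forall fun x => (div_eq_inv_mul _ _).symm)
  have hC' : ∀ j, ∀ᵐ x ∂D.vol, |φ j x / b j| ≤ C j / b j := fun j => by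
    filter_upwards [hC j] with x hx
    rw [abs_div, abs_of_pos (hb j)]
    exact div_le_div_of_nonneg_right hx (hb j).le
  -- The normalisation `b^S = b_j b^{S \ {j}}` turns each weight `φ j` into `φ j / b j`.
  have hg : ∀ S, S.Nonempty → weightedForm D a ((β S)⁻¹ • w S) ((β S)⁻¹ • w S) =
      -∑ j ∈ S, weightedForm D (fun x => φ j x / b j)
        ((β (S.erase j))⁻¹ • w (S.erase j)) ((β S)⁻¹ • w S) := by
    intro S hS
    rw [weightedForm_smul_left, hw S hS, mul_neg, Finset.mul_sum]
    congr 1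
    refine Finset.sum_congr rfl fun j hj => ?_
    rw [weightedForm_div, weightedForm_smul_left, ← mul_assoc, ← mul_inv, hβ,
      Finset.mul_prod_erase S b hj]
  have hα' : weightedForm D a (w ∅) (w ∅) ≤ ‖f‖ ^ 2 / α :=
    weightedForm_self_le_of_forall_eq ha hCa hα0 hα f hw0
  -- Young's inequality needs a positive weight, while `q` may be zero; the bound is proved for `Q >
  -- q` and passed to the limit.
  have hbound : ∀ Q : ℝ, q < Q →
      ((β S₀)⁻¹ * ‖w S₀‖) ^ 2 * α ≤ (Q ^ 2) ^ S₀.card * (‖f‖ ^ 2 / α) := by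
    intro Q hqQ
    have hQ : ∀ᵐ x ∂D.vol, ∑ j ∈ S₀, |φ j x / b j| ≤ Q * a x := by
      filter_upwards [hq, hα] with x h1 h2
      exact h1.trans (mul_le_mul_of_nonneg_right hqQ.le (hα0.le.trans h2))
    have h1 := weightedForm_le_pow_mul ha hCa hφ' hC' (hq0.trans_lt hqQ) hQ
      (fun S => (β S)⁻¹ • w S) hg
    have h2 := mul_norm_sq_le_weightedForm ha hCa hα ((β S₀)⁻¹ • w S₀)
    rw [norm_smul, norm_inv, Real.norm_of_nonneg (hβ0 S₀).le] at h2
    have h3 : (β ∅)⁻¹ • w ∅ = w ∅ := by simp [hβ]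
    simp only [h3] at h1
    rw [mul_comm]
    exact h2.trans (h1.trans (mul_le_mul_of_nonneg_left hα' (by positivity)))
  have hlim : ((β S₀)⁻¹ * ‖w S₀‖) ^ 2 * α ≤ (q ^ 2) ^ S₀.card * (‖f‖ ^ 2 / α) := by
    have hcont : Continuous fun Q : ℝ => (Q ^ 2) ^ S₀.card * (‖f‖ ^ 2 / α) := by fun_prop
    refine ge_of_tendsto (hcont.continuousWithinAt (s := Ioi q) (x := q)).tendsto ?_
    filter_upwards [self_mem_nhdsWithin] with Q hQ
    exact hbound Q hQ
  have hsq : ((β S₀)⁻¹ * ‖w S₀‖) ^ 2 ≤ (q ^ S₀.card * (‖f‖ / α)) ^ 2 := by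
    have e : (q ^ S₀.card * (‖f‖ / α)) ^ 2 = (q ^ 2) ^ S₀.card * (‖f‖ ^ 2 / α) / α := by
      rw [mul_pow, ← pow_mul, mul_comm S₀.card, pow_mul]
      field_simp
    rw [e, le_div_iff₀ hα0]
    exact hlim
  have h := (pow_le_pow_iff_left₀ (mul_nonneg (inv_nonneg.2 (hβ0 S₀).le) (norm_nonneg _))
    (by positivity) two_ne_zero).1 hsq
  rwa [inv_mul_le_iff₀ (hβ0 S₀), ← mul_assoc] at h

end EnergyBound

/-- Lax–Milgram in operator form. -/
theorem isUnit_of_coercive {H : Type*} [NormedAddCommGroup H] [InnerProductSpace ℝ H]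
    [CompleteSpace H] {T : H →L[ℝ] H} {α : ℝ} (hα : 0 < α)
    (hT : ∀ v, α * ‖v‖ ^ 2 ≤ inner ℝ (T v) v) : IsUnit T :=
  T.isUnit_of_forall_le_norm_inner_map (c := ⟨α, hα.le⟩) hα fun v => by
    rw [mul_comm]
    exact (hT v).trans (le_abs_self _)

end ParametricPDE

/-! ### The main theorem -/

open ParametricPDE
theorem corollary1 {d : ℕ} [NeZero d] (D : BoundedOpen d)
    (a₀ : EuclideanSpace ℝ (Fin d) → ℝ) (ψ : ℕ → EuclideanSpace ℝ (Fin d) → ℝ)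
    (ha₀ : AEStronglyMeasurable a₀ D.vol) (hψ : ∀ j, AEStronglyMeasurable (ψ j) D.vol)
    (a0min a0max : ℝ) (ha0min : 0 < a0min)
    (ha₀_bounds : ∀ᵐ x ∂D.vol, a0min ≤ a₀ x ∧ a₀ x ≤ a0max)
    (κbar : ℝ) (hκbar_pos : 0 < κbar) (hκbar_lt : κbar < 1)
    (hκbar : relNorm D a₀ ψ (fun _ => 1) Set.univ ≤ ENNReal.ofReal κbar)
    (b : ℕ → ℝ) (hb : ∀ j, 0 < b j ∧ b j ≤ 1)
    (hκ : kappa D a₀ ψ b < 1) :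
    (∀ k : ℕ,
      (∀ ν ∈ F₁, ν.degree = k → kappaTilde D a₀ ψ b ν ≤ kappaOrder D a₀ ψ b k) ∧
      kappaOrder D a₀ ψ b k ≤ kappa D a₀ ψ b ∧ kappa D a₀ ψ b < 1) ∧
    ∀ f : StrongDual ℝ (H01 D),
      -- the weak problem is uniquely solvable for every parameter
      (∀ y ∈ U, ∃! w : H01 D, IsWeakSolution D a₀ ψ f y w) ∧
      -- and for the solution map `u`
      ∀ u : (ℕ → ℝ) → H01 D, (∀ y ∈ U, IsWeakSolution D a₀ ψ f y (u y)) →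
        ∀ ν ∈ F₁, ∀ y ∈ U,
          -- the mixed first-order derivatives exist, whatever the order of differentiation
          (∀ j ∉ ν.support,
            HasDerivWithinAt (fun t => mixedDeriv ν u (Function.update y j t))
              (mixedDeriv (ν + Finsupp.single j 1) u y) (Set.Icc (-(1 / 2)) (1 / 2)) (y j)) ∧
          -- and obey the bound
          ‖mixedDeriv ν u y‖ ≤
            (ν.prod fun j n => b j ^ n) *
              (2 * (kappaOrder D a₀ ψ b ν.degree).toReal / (1 - κbar)) ^ ν.degree *
              (‖f‖ / ((1 - κbar) * a0min)) := by

  refine ⟨fun k => ⟨?_, kappaOrder_le_kappa D a₀ ψ b k, hκ⟩, fun f => ?_⟩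
  · rintro ν hν rfl
    exact kappaTilde_le_kappaOrder D a₀ ψ b hν
  have hpos : ∀ᵐ x ∂D.vol, 0 < a₀ x := ha₀_bounds.mono fun x hx => ha0min.trans_le hx.1
  have hsum := ae_summable_and_tsum_le hκbar_pos.le hpos hκbar
  set α : ℝ := (1 - κbar) * a0min with hα
  have hα0 : 0 < α := mul_pos (by linarith) ha0min
  have hlow : ∀ y ∈ U, ∀ᵐ x ∂D.vol, (1 - κbar) * a₀ x ≤ coeff a₀ ψ x y := fun y hy => by
    filter_upwards [hsum] with x hx
    have h := (abs_le.1 (abs_tsum_parametric_le hx.1 hy)).1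
    rw [coeff]
    linarith [hx.2]
  have hcoer : ∀ y ∈ U, ∀ᵐ x ∂D.vol, α ≤ coeff a₀ ψ x y := fun y hy => by
    filter_upwards [hlow y hy, ha₀_bounds] with x h1 h2
    exact (mul_le_mul_of_nonneg_left h2.1 (by linarith)).trans h1
  -- The fluctuation is at most `κbar * a₀ ≤ a₀`, whence the factor 2.
  have hup : ∀ y ∈ U, ∀ᵐ x ∂D.vol, |coeff a₀ ψ x y| ≤ 2 * a0max := fun y hy => by
    filter_upwards [hsum, hpos, ha₀_bounds] with x hx h0 h1
    have h := abs_le.1 (abs_tsum_parametric_le hx.1 hy)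
    have h2 : κbar * a₀ x ≤ a₀ x := mul_le_of_le_one_left h0.le hκbar_lt.le
    rw [coeff, abs_le]
    constructor <;> linarith [hx.2]
  have hψb : ∀ j, ∀ᵐ x ∂D.vol, |ψ j x| ≤ 2 * a0max := fun j => by
    filter_upwards [hsum, hpos, ha₀_bounds] with x hx h0 h1
    have h := hx.1.le_tsum j fun i _ => abs_nonneg _
    have h2 : κbar * a₀ x ≤ a₀ x := mul_le_of_le_one_left h0.le hκbar_lt.le
    linarith [hx.2]
  have hmeas : ∀ y ∈ U, AEStronglyMeasurable (fun x => coeff a₀ ψ x y) D.vol := fun y hy =>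
    aestronglyMeasurable_coeff ha₀ hψ (hsum.mono fun x hx => hx.1) hy
  -- Off `U` the series need not converge; the operator is set to zero there.
  have hexA : ∀ y, ∃ T : H01 D →L[ℝ] H01 D, y ∈ U → ∀ w v,
      inner ℝ (T w) v = weightedForm D (fun x => coeff a₀ ψ x y) w v := fun y => by
    by_cases hy : y ∈ U
    · obtain ⟨T, hT⟩ := exists_operator_weightedForm (hmeas y hy) (hup y hy)
      exact ⟨T, fun _ => hT⟩
    · exact ⟨0, fun h => absurd h hy⟩
  choose A hA using hexA
  choose B hB using fun j => exists_operator_weightedForm (hψ j) (hψb j)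
  have hunit : ∀ y ∈ U, IsUnit (A y) := fun y hy =>
    isUnit_of_coercive hα0 fun v => by
      rw [hA y hy]
      exact mul_norm_sq_le_weightedForm (hmeas y hy) (hup y hy) (hcoer y hy) v
  have hAB : ∀ y ∈ U, ∀ j, ∀ t ∈ Icc (-(1 / 2) : ℝ) (1 / 2),
      A (Function.update y j t) = A y + (t - y j) • B j := by
    intro y hy j t ht
    refine ContinuousLinearMap.ext fun w => ext_inner_right ℝ fun v => ?_
    rw [hA _ (update_mem_U hy j ht), add_apply, smul_apply, inner_add_left,
      real_inner_smul_left, hA y hy, hB, weightedForm, weightedForm, weightedForm,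
      ← integral_const_mul, ← integral_add
        (integrable_weight_mul_inner (hmeas y hy) (hup y hy) w v)
        ((integrable_weight_mul_inner (hψ j) (hψb j) w v).const_mul _)]
    refine integral_congr_ae ?_
    filter_upwards [hsum] with x hx
    rw [coeff_update hx.1 hy]
    ring
  set F : H01 D := (InnerProductSpace.toDual ℝ (H01 D)).symm f with hF
  have hFv : ∀ v, inner ℝ F v = f v := fun v => InnerProductSpace.toDual_symm_apply
  have hsol : ∀ y ∈ U, ∀ w, IsWeakSolution D a₀ ψ f y w ↔ A y w = F := by
    intro y hy w
    constructor
    · intro h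
      refine ext_inner_right ℝ fun v => ?_
      rw [hA y hy, hFv]
      exact h v
    · intro h v
      rw [← hFv, ← h, hA y hy]
      rfl
  have hAsol : ∀ y ∈ U, ∀ w, A y w = F ↔ w = solutionDeriv A B F ∅ y := by
    intro y hy w
    have h0 : A y (solutionDeriv A B F ∅ y) = F := by
      simpa using apply_solutionDeriv (B := B) (F := F) (hunit y hy) ∅
    constructor
    · intro h
      have h1 := congrArg (fun z => (Ring.inverse (A y) : H01 D →L[ℝ] H01 D) z) (h.trans h0.symm)
      rwa [← mul_apply_eq_comp, ← mul_apply_eq_comp, Ring.inverse_mul_cancel _ (hunit y hy),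
        one_apply_eq_self, one_apply_eq_self] at h1
    · rintro rfl
      exact h0
  refine ⟨fun y hy => ⟨solutionDeriv A B F ∅ y, (hsol y hy _).2 ((hAsol y hy _).2 rfl),
    fun w hw => (hAsol y hy w).1 ((hsol y hy w).1 hw)⟩, fun u hu ν hν y hy => ⟨fun j hj => ?_, ?_⟩⟩
  · have hu' : ∀ y ∈ U, u y = solutionDeriv A B F ∅ y := fun y hy =>
      (hAsol y hy _).1 ((hsol y hy _).1 (hu y hy))
    rw [mixedDeriv_eq_solutionDeriv hunit hAB hu' (add_single_mem_F₁ hν hj) hy,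
      support_add_single]
    exact (hasDerivWithinAt_solutionDeriv hunit hAB hy ν.support hj).congr
      (fun t ht => mixedDeriv_eq_solutionDeriv hunit hAB hu' hν (update_mem_U hy j ht))
      (mixedDeriv_eq_solutionDeriv hunit hAB hu' hν (update_mem_U hy j (hy j)))
  · have hu' : ∀ y ∈ U, u y = solutionDeriv A B F ∅ y := fun y hy =>
      (hAsol y hy _).1 ((hsol y hy _).1 (hu y hy))
    rw [mixedDeriv_eq_solutionDeriv hunit hAB hu' hν hy, prod_pow_eq_prod_support hν]
    set κ := (kappaOrder D a₀ ψ b ν.degree).toReal with hκdef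
    -- Since `κ(k) ≤ κ < 1` is finite, `toReal` loses nothing.
    have hκν : relNorm D a₀ ψ b ν.support ≤ ENNReal.ofReal κ := by
      rw [ENNReal.ofReal_toReal
        ((kappaOrder_le_kappa D a₀ ψ b _).trans_lt (hκ.trans ENNReal.one_lt_top)).ne]
      exact kappaTilde_le_kappaOrder D a₀ ψ b hν
    have hκ0 : 0 ≤ κ := ENNReal.toReal_nonneg
    have h1κ : 0 < 1 - κbar := by linarith
    rw [degree_eq_card_support hν]
    refine norm_le_prod_mul_pow_mul (hmeas y hy) (hup y hy) hα0 (hcoer y hy) hψ hψb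
      (fun j => (hb j).1) (by positivity) ?_ f (fun S => solutionDeriv A B F S y) ?_ ?_
    -- Origin of the ratio: `∑ |ψ_j| / b_j ≤ 2 κ a₀`, and `a₀ ≤ a / (1 - κbar)`.
    · filter_upwards [ae_finset_sum_le (fun j => (hb j).1) hpos ν.support hκ0 hκν,
        hlow y hy] with x h1 h2
      refine h1.trans ?_
      rw [div_mul_eq_mul_div, le_div_iff₀ h1κ]
      nlinarith
    · intro v
      rw [← hA y hy, (hAsol y hy _).2 rfl, hFv]
    · intro S hS v
      rw [← hA y hy, apply_solutionDeriv (hunit y hy), if_neg hS.ne_empty, zero_sub,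
        inner_neg_left, sum_inner]
      simp only [hB]
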